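/- Let $\mathbb{D}=\{z\in\mathbb{C}:|z|<1\}$, let $\mathbb{T}$ be the unit circle, and let $w:[0,1)\to(0,1)$ be a decreasing (that is, non-increasing) function with $\lim_{t\to 1^-}w(t)=0$. Then there exists a non-zero finite positive Borel measure $\nu$ on $\mathbb{T}$, singular with respect to Lebesgue measure, such that the singular inner function $$\theta(z)=S_\nu(z)=\exp\Big(-\int_{\mathbb{T}}\frac{\zeta+z}{\zeta-z}\,d\nu(\zeta)\Big),\qquad z\in\mathbb{D},$$ has the following properties. There is a sequence of analytic polynomials $\{p_n\}_n$ such that (i) $\lim_{n\to\infty}\theta(z)p_n(z)=1$ for every $z\in\mathbb{D}$, (ii) $\sup_{z\in\mathbb{D}}|\theta(z)p_n(z)|\,w(|z|)\le 2$ for every $n$. Moreover, $\theta$ is cyclic in the growth class of all analytic functions $f$ on $\mathbb{D}$ with $\|f\|_w:=\sup_{z\in\mathbb{D}}|f(z)|\,w(|z|)<\infty$: it belongs to this class, and there are analytic polynomials $q_n$ with $\|\theta q_n-1\|_w\to 0$. -/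

import Mathlib

open MeasureTheory Filter Topology Set

noncomputable section

/-- The Borel sigma-algebra of the unit circle. -/
instance circleMeasurableSpace : MeasurableSpace Circle := borel Circle

instance circleBorelSpace : BorelSpace Circle := ⟨rfl⟩

/-- The normalized Lebesgue measure (normalized arc length) `m` on the unit circle. -/
def circleLebesgue : Measure Circle :=
  (ENNReal.ofReal (2 * Real.pi))⁻¹ •
    (volume.restrict (Ioc (-Real.pi) Real.pi)).map Circle.exp

/-- The function `S_ν(z) = exp (-∫ (ζ + z) / (ζ - z) dν(ζ))` associated with a measure `ν` on the
unit circle. -/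
def singularInner (ν : Measure Circle) (z : ℂ) : ℂ :=
  Complex.exp (-∫ ζ : Circle, ((ζ : ℂ) + z) / ((ζ : ℂ) - z) ∂ν)

/-- The (non-zero, finite, positive Borel) measures `ν` on the circle that are singular with respect
to Lebesgue measure: exactly those for which `S_ν` is a (non-constant) singular inner function. -/
structure IsSingularMeasure (ν : Measure Circle) : Prop where
  finite : IsFiniteMeasure ν
  ne_zero : ν ≠ 0
  mutuallySingular : ν ⟂ₘ circleLebesgue

/-- The growth class of the weight `w`: the functions `f` analytic in the open unit disk with
`sup_{|z| < 1} |f z| w(|z|) < ∞`. -/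
def growthClass (w : ℝ → ℝ) : Set (ℂ → ℂ) :=
  {f | AnalyticOnNhd ℂ f (Metric.ball 0 1) ∧
    ∃ C : ℝ, ∀ z ∈ Metric.ball (0 : ℂ) 1, ‖f z‖ * w ‖z‖ ≤ C}

/-- `g` is cyclic in the growth class of `w`: it belongs to the class, and there are polynomials
`p n` such that `g * p n` converges to the constant `1` in the norm
`f ↦ sup_{|z| < 1} |f z| w(|z|)` of the class. -/
def IsCyclicInGrowthClass (w : ℝ → ℝ) (g : ℂ → ℂ) : Prop :=
  g ∈ growthClass w ∧ ∃ p : ℕ → Polynomial ℂ, ∀ ε : ℝ, 0 < ε → ∀ᶠ n in atTop,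
    ∀ z ∈ Metric.ball (0 : ℂ) 1, ‖g z * (p n).eval z - 1‖ * w ‖z‖ ≤ ε

end

/-! Write θ = exp(-H), with H the Herglotz integral of ν. The polynomials approximate 1/θ(ρz) =
exp(H(ρz)), analytic beyond the closed disk. Then θ(z)/θ(ρz) is near 1 on |z| ≤ r if ρ is close to
1, and elsewhere it is at most exp(M), M bounding Re H on |z| ≤ ρ; the weight absorbs exp(M) near
the circle. Hence M must be known before r and ρ are chosen. This is possible because singular
measures can have arbitrarily slowly growing Poisson integrals: for any radii ρ n < 1 some singular
probability measure has Re H ≤ 2^n + 1 on |z| ≤ ρ n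
(`exists_mutuallySingular_re_herglotzIntegral_le`). That measure is the law of exp(2πix), x uniform
on [0, 1) with the binary digits m 0 < m 1 < ... replaced by 0. Infinitely many vanishing digits
make it singular. Erasing the first n alone gives density at most 2^n, hence Poisson integral at
most 2^n; the remaining erasures move x by at most 2 · 2^(-m n), which is invisible on |z| ≤ ρ n
when m n is large. -/

/-! ### Erasing one binary digit -/

/-- Replaces the `m`-th binary digit of `x` by `0`. -/
noncomputable def eraseDigit (m : ℕ) (x : ℝ) : ℝ :=
  if Odd ⌊2 ^ m * x⌋ then x - (2 ^ m)⁻¹ else x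

theorem floor_two_pow_mul_eq_ediv {j m : ℕ} (h : j ≤ m) (x : ℝ) :
    ⌊2 ^ j * x⌋ = ⌊2 ^ m * x⌋ / 2 ^ (m - j) := by
  have := Int.floor_div_natCast (2 ^ m * x) (2 ^ (m - j))
  push_cast at this
  rw [← this]
  congr 1
  rw [eq_div_iff (by positivity)]
  nth_rewrite 2 [← Nat.add_sub_cancel' h]
  rw [pow_add]
  ring

theorem floor_two_pow_mul_sub_self (m : ℕ) (x : ℝ) :
    ⌊2 ^ m * (x - (2 ^ m)⁻¹)⌋ = ⌊2 ^ m * x⌋ - 1 := by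
  rw [mul_sub, mul_inv_cancel₀ (by positivity), Int.floor_sub_one]

/-- Lowering an odd integer by 1 does not change its quotient by 2, so no coarser digit is affected.
-/
theorem floor_two_pow_mul_sub {j m : ℕ} (h : j < m) {x : ℝ} (hx : Odd ⌊2 ^ m * x⌋) :
    ⌊2 ^ j * (x - (2 ^ m)⁻¹)⌋ = ⌊2 ^ j * x⌋ := by
  rw [floor_two_pow_mul_eq_ediv h.le, floor_two_pow_mul_eq_ediv h.le x,
    floor_two_pow_mul_sub_self]
  obtain ⟨a, ha⟩ := hx
  obtain ⟨k, hk⟩ : ∃ k, m - j = k + 1 := ⟨m - j - 1, by omega⟩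
  rw [ha, hk, pow_succ', ← Int.ediv_ediv_of_nonneg (by norm_num),
    ← Int.ediv_ediv_of_nonneg (by norm_num)]
  congr 1
  omega

theorem floor_two_pow_mul_eraseDigit {j m : ℕ} (h : j < m) (x : ℝ) :
    ⌊2 ^ j * eraseDigit m x⌋ = ⌊2 ^ j * x⌋ := by
  unfold eraseDigit
  split_ifs with hx
  · exact floor_two_pow_mul_sub h hx
  · rfl

theorem even_floor_eraseDigit (m : ℕ) (x : ℝ) : Even ⌊2 ^ m * eraseDigit m x⌋ := by
  unfold eraseDigit
  split_ifs with hx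
  · rw [floor_two_pow_mul_sub_self]
    exact hx.sub_odd odd_one
  · exact Int.not_odd_iff_even.1 hx

theorem floor_eraseDigit {m : ℕ} (h : 0 < m) (x : ℝ) : ⌊eraseDigit m x⌋ = ⌊x⌋ := by
  simpa using floor_two_pow_mul_eraseDigit h x

theorem eraseDigit_le (m : ℕ) (x : ℝ) : eraseDigit m x ≤ x := by
  unfold eraseDigit
  split_ifs
  · exact sub_le_self _ (by positivity)
  · exact le_rfl

theorem sub_le_eraseDigit (m : ℕ) (x : ℝ) : x - (2 ^ m)⁻¹ ≤ eraseDigit m x := by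
  unfold eraseDigit
  split_ifs
  · exact le_rfl
  · exact sub_le_self _ (by positivity)

theorem measurable_floor_two_pow_mul (m : ℕ) : Measurable fun x : ℝ => ⌊2 ^ m * x⌋ :=
  Int.measurable_floor.comp (measurable_const_mul _)

theorem measurable_eraseDigit (m : ℕ) : Measurable (eraseDigit m) := by
  refine Measurable.ite ?_ (measurable_id.sub_const _) measurable_id
  exact measurable_floor_two_pow_mul m (MeasurableSet.of_discrete (s := {k : ℤ | Odd k}))

theorem mem_Ico_zero_one_iff_floor {x : ℝ} : x ∈ Ico (0 : ℝ) 1 ↔ ⌊x⌋ = 0 :=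
  Int.floor_eq_zero_iff.symm

/-- Erasure is the identity or a fixed translation, so a preimage lies in the union of two sets,
each with the measure of the target. Positivity of `m` keeps the integer part, hence [0, 1), fixed.
-/
theorem map_eraseDigit_le {m : ℕ} (h : 0 < m) :
    (volume.restrict (Ico (0 : ℝ) 1)).map (eraseDigit m) ≤
      (2 : ENNReal) • volume.restrict (Ico (0 : ℝ) 1) := by
  refine Measure.le_iff.2 fun A hA => ?_
  rw [Measure.map_apply (measurable_eraseDigit m) hA, Measure.smul_apply,
    Measure.restrict_apply (measurable_eraseDigit m hA), Measure.restrict_apply hA]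
  have hsub : eraseDigit m ⁻¹' A ∩ Ico 0 1 ⊆
      (A ∩ Ico 0 1) ∪ (fun x => x - (2 ^ m)⁻¹) ⁻¹' (A ∩ Ico 0 1) := by
    rintro x ⟨hxA, hx⟩
    have h1 : eraseDigit m x ∈ A ∩ Ico 0 1 := by
      refine ⟨hxA, ?_⟩
      rw [mem_Ico_zero_one_iff_floor, floor_eraseDigit h]
      exact mem_Ico_zero_one_iff_floor.1 hx
    rw [eraseDigit] at h1
    split_ifs at h1
    · exact Or.inr h1
    · exact Or.inl h1
  calc _ ≤ _ := measure_mono hsub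
    _ ≤ _ := measure_union_le _ _
    _ = _ := by simp only [sub_eq_add_neg, measure_preimage_add_right, smul_eq_mul, two_mul]

/-! ### Erasing infinitely many digits -/

/-- Replaces the binary digits of `x` with indices `m 0, …, m (n - 1)` by `0`. -/
noncomputable def eraseDigits (m : ℕ → ℕ) : ℕ → ℝ → ℝ
  | 0, x => x
  | n + 1, x => eraseDigit (m n) (eraseDigits m n x)

/-- Replaces the binary digits of `x` with indices in the range of `m` by `0`. -/
noncomputable def eraseAllDigits (m : ℕ → ℕ) (x : ℝ) : ℝ := ⨅ n, eraseDigits m n x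

theorem measurable_eraseDigits (m : ℕ → ℕ) (n : ℕ) : Measurable (eraseDigits m n) := by
  induction n with
  | zero => exact measurable_id
  | succ n ih => exact (measurable_eraseDigit _).comp ih

theorem map_eraseDigits_le {m : ℕ → ℕ} (hm : ∀ n, 0 < m n) (n : ℕ) :
    (volume.restrict (Ico (0 : ℝ) 1)).map (eraseDigits m n) ≤
      (2 ^ n : ENNReal) • volume.restrict (Ico (0 : ℝ) 1) := by
  induction n with
  | zero =>
    have : eraseDigits m 0 = id := rfl
    simp [this]
  | succ n ih =>
    have : eraseDigits m (n + 1) = eraseDigit (m n) ∘ eraseDigits m n := rfl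
    rw [this, ← Measure.map_map (measurable_eraseDigit _) (measurable_eraseDigits m n)]
    calc _ ≤ _ := Measure.map_mono ih (measurable_eraseDigit _)
      _ = _ := Measure.map_smul _ _ _
      _ ≤ (2 ^ n : ENNReal) • ((2 : ENNReal) • volume.restrict (Ico (0 : ℝ) 1)) := by
        gcongr
        exact map_eraseDigit_le (hm n)
      _ = _ := by rw [smul_smul, pow_succ]

theorem floor_eraseDigits {m : ℕ → ℕ} (hm : ∀ n, 0 < m n) (n : ℕ) (x : ℝ) :
    ⌊eraseDigits m n x⌋ = ⌊x⌋ := by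
  induction n with
  | zero => rfl
  | succ n ih => rw [eraseDigits, floor_eraseDigit (hm n), ih]

theorem even_floor_eraseDigits {m : ℕ → ℕ} (hm : StrictMono m) {k n : ℕ} (h : k < n) (x : ℝ) :
    Even ⌊2 ^ m k * eraseDigits m n x⌋ := by
  induction n, h using Nat.le_induction with
  | base => exact even_floor_eraseDigit _ _
  | succ n hn ih =>
    rw [eraseDigits, floor_two_pow_mul_eraseDigit (hm hn)]
    exact ih

theorem antitone_eraseDigits (m : ℕ → ℕ) (x : ℝ) : Antitone fun n => eraseDigits m n x :=
  antitone_nat_of_succ_le fun _ => eraseDigit_le _ _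

theorem floor_le_eraseDigits {m : ℕ → ℕ} (hm : ∀ n, 0 < m n) (n : ℕ) (x : ℝ) :
    (⌊x⌋ : ℝ) ≤ eraseDigits m n x := by
  rw [← floor_eraseDigits hm n]
  exact Int.floor_le _

theorem bddBelow_eraseDigits {m : ℕ → ℕ} (hm : ∀ n, 0 < m n) (x : ℝ) :
    BddBelow (range fun n => eraseDigits m n x) :=
  ⟨⌊x⌋, by rintro _ ⟨n, rfl⟩; exact floor_le_eraseDigits hm n x⟩

theorem tendsto_eraseDigits {m : ℕ → ℕ} (hm : ∀ n, 0 < m n) (x : ℝ) :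
    Tendsto (fun n => eraseDigits m n x) atTop (𝓝 (eraseAllDigits m x)) :=
  tendsto_atTop_ciInf (antitone_eraseDigits m x) (bddBelow_eraseDigits hm x)

theorem measurable_eraseAllDigits {m : ℕ → ℕ} (hm : ∀ n, 0 < m n) :
    Measurable (eraseAllDigits m) :=
  measurable_of_tendsto_metrizable (measurable_eraseDigits m)
    (tendsto_pi_nhds.2 fun x => tendsto_eraseDigits hm x)

/-- The partial erasures decrease to the limit and the floor is right-continuous, so each erased
digit is still 0 in the limit. -/
theorem even_floor_eraseAllDigits {m : ℕ → ℕ} (hm : StrictMono m) (hm0 : ∀ n, 0 < m n) (k : ℕ)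
    (x : ℝ) : Even ⌊2 ^ m k * eraseAllDigits m x⌋ := by
  have h1 : Tendsto (fun n => 2 ^ m k * eraseDigits m n x) atTop
      (𝓝 (2 ^ m k * eraseAllDigits m x)) := (tendsto_eraseDigits hm0 x).const_mul _
  have h2 : ∀ᶠ n in atTop, 2 ^ m k * eraseDigits m n x < ⌊2 ^ m k * eraseAllDigits m x⌋ + 1 :=
    h1.eventually_lt_const (Int.lt_floor_add_one _)
  obtain ⟨n, hn, hkn⟩ := (h2.and (eventually_gt_atTop k)).exists
  have h3 : ⌊2 ^ m k * eraseDigits m n x⌋ = ⌊2 ^ m k * eraseAllDigits m x⌋ := by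
    rw [Int.floor_eq_iff]
    refine ⟨(Int.floor_le _).trans ?_, hn⟩
    gcongr
    exact ciInf_le (bddBelow_eraseDigits hm0 x) n
  rw [← h3]
  exact even_floor_eraseDigits hm hkn x

/-- Strict monotonicity gives m (k + n) ≥ m n + k, so the remaining displacements are dominated by a
geometric series of ratio 1/2. -/
theorem abs_eraseDigits_sub_eraseAllDigits_le {m : ℕ → ℕ} (hm : StrictMono m)
    (hm0 : ∀ n, 0 < m n) (n : ℕ) (x : ℝ) :
    |eraseDigits m n x - eraseAllDigits m x| ≤ 2 * (2 ^ m n)⁻¹ := by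
  rw [← Real.dist_eq, ← Nat.zero_add n]
  refine dist_le_of_le_geometric_two_of_tendsto₀ (f := fun k => eraseDigits m (k + n) x) ?_ ?_
  · intro k
    rw [Nat.zero_add, mul_div_cancel_left₀ _ two_ne_zero, ← one_div, div_div, ← pow_add, one_div,
      Real.dist_eq, abs_of_nonneg (sub_nonneg.2 (antitone_eraseDigits m x (by omega)))]
    have h1 := sub_le_eraseDigit (m (k + n)) (eraseDigits m (k + n) x)
    have h2 : ((2 : ℝ) ^ m (k + n))⁻¹ ≤ (2 ^ (m n + k))⁻¹ := by
      gcongr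
      · norm_num
      · rw [add_comm]; exact hm.add_le_nat k n
    have h3 : eraseDigits m (k + 1 + n) x = eraseDigit (m (k + n)) (eraseDigits m (k + n) x) := by
      rw [add_right_comm]; rfl
    change eraseDigits m (k + n) x - eraseDigits m (k + 1 + n) x ≤ _
    rw [h3]
    linarith
  · exact (tendsto_add_atTop_iff_nat n).2 (tendsto_eraseDigits hm0 x)

/-! ### Nullity of the set of reals with vanishing digits -/

/-- The set of reals all of whose binary digits with indices `m 0, …, m (n - 1)` vanish. -/
def digitsVanish (m : ℕ → ℕ) (n : ℕ) : Set ℝ := {x | ∀ k < n, Even ⌊2 ^ m k * x⌋}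

theorem measurableSet_digitsVanish (m : ℕ → ℕ) (n : ℕ) : MeasurableSet (digitsVanish m n) := by
  simp only [digitsVanish, ofPred_forall]
  exact MeasurableSet.iInter fun k => MeasurableSet.iInter fun _ =>
    measurable_floor_two_pow_mul (m k) (MeasurableSet.of_discrete (s := {k : ℤ | Even k}))

/-- Each further condition at least halves the measure: translating by 2^(-m n) switches digit m n
from 0 to 1, which yields a disjoint copy still satisfying the earlier conditions. -/
theorem volume_digitsVanish_inter_le {m : ℕ → ℕ} (hm : StrictMono m) (hm0 : ∀ n, 0 < m n)
    (n : ℕ) (i : ℤ) : 2 ^ n * volume (digitsVanish m n ∩ {x | ⌊x⌋ = i}) ≤ 1 := by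
  induction n with
  | zero =>
    have : {x : ℝ | ⌊x⌋ = i} = Ico (i : ℝ) (i + 1) := Int.preimage_floor_singleton i
    simp [digitsVanish, this]
  | succ n ih =>
    refine le_trans ?_ ih
    set A := digitsVanish m (n + 1) ∩ {x | ⌊x⌋ = i}
    have hAm : MeasurableSet A := (measurableSet_digitsVanish m _).inter
      (Int.measurable_floor (MeasurableSet.of_discrete (s := {i})))
    set B := (fun x => x - (2 ^ m n)⁻¹) ⁻¹' A with hB
    have hodd : ∀ x ∈ B, Odd ⌊2 ^ m n * x⌋ := fun x hx => by
      have := hx.1 n (Nat.lt_succ_self n)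
      rw [floor_two_pow_mul_sub_self] at this
      simpa using this.add_odd odd_one
    have hdisj : Disjoint A B := Set.disjoint_left.2 fun x hxA hxB =>
      Int.not_odd_iff_even.2 (hxA.1 n (Nat.lt_succ_self n)) (hodd x hxB)
    have hsub : A ∪ B ⊆ digitsVanish m n ∩ {x | ⌊x⌋ = i} := by
      rintro x (hx | hx)
      · exact ⟨fun k hk => hx.1 k (hk.trans n.lt_succ_self), hx.2⟩
      · refine ⟨fun k hk => ?_, ?_⟩
        · have := hx.1 k (hk.trans n.lt_succ_self)
          rwa [floor_two_pow_mul_sub (hm hk) (hodd x hx)] at this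
        · have h1 : ⌊x - (2 ^ m n)⁻¹⌋ = i := hx.2
          have h2 := floor_two_pow_mul_sub (hm0 n) (hodd x hx)
          simp only [pow_zero, one_mul] at h2
          exact h2.symm.trans h1
    calc 2 ^ (n + 1) * volume A = 2 ^ n * (volume A + volume B) := by
          simp only [hB, sub_eq_add_neg, measure_preimage_add_right]
          rw [← two_mul, pow_succ, mul_assoc]
      _ = 2 ^ n * volume (A ∪ B) := by
          rw [measure_union hdisj (measurable_id.sub_const _ hAm)]
      _ ≤ _ := by gcongr

theorem volume_iInter_digitsVanish {m : ℕ → ℕ} (hm : StrictMono m) (hm0 : ∀ n, 0 < m n) :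
    volume (⋂ n, digitsVanish m n) = 0 := by
  have key : ∀ i : ℤ, volume ((⋂ n, digitsVanish m n) ∩ {x | ⌊x⌋ = i}) = 0 := fun i => by
    by_contra h
    have h1 : ∀ n : ℕ, (2 : ENNReal) ^ n ≤
        (volume ((⋂ n, digitsVanish m n) ∩ {x | ⌊x⌋ = i}))⁻¹ := fun n => by
      rw [ENNReal.le_inv_iff_mul_le]
      refine le_trans ?_ (volume_digitsVanish_inter_le hm hm0 n i)
      gcongr
      exact iInter_subset _ n
    have h2 := le_of_tendsto' (ENNReal.tendsto_pow_atTop_nhds_top_iff.2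
      (by norm_num : (1 : ENNReal) < 2)) (fun n => h1 n)
    exact h (by simpa using h2)
  refine measure_mono_null (fun x hx => ?_) (measure_iUnion_null key)
  exact mem_iUnion.2 ⟨⌊x⌋, hx, rfl⟩

theorem eraseAllDigits_mem_iInter_digitsVanish {m : ℕ → ℕ} (hm : StrictMono m)
    (hm0 : ∀ n, 0 < m n) (x : ℝ) : eraseAllDigits m x ∈ ⋂ n, digitsVanish m n :=
  mem_iInter.2 fun _ k _ => even_floor_eraseAllDigits hm hm0 k x

/-- Needed because the argument of a point of the circle recovers x only modulo integers. -/
theorem sub_intCast_mem_iInter_digitsVanish {m : ℕ → ℕ} (hm0 : ∀ n, 0 < m n) {x : ℝ}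
    (hx : x ∈ ⋂ n, digitsVanish m n) (i : ℤ) : x - i ∈ ⋂ n, digitsVanish m n := by
  refine mem_iInter.2 fun n k hk => ?_
  have h1 := mem_iInter.1 hx n k hk
  have h2 : (2 : ℝ) ^ m k * (x - i) = 2 ^ m k * x - ((2 ^ m k * i : ℤ) : ℝ) := by
    push_cast; ring
  rw [h2, Int.floor_sub_intCast]
  exact h1.sub ((even_two.pow_of_ne_zero (hm0 k).ne').mul_right _)

/-! ### The Herglotz kernel and its integral -/

theorem one_sub_le_norm_sub {ζ z : ℂ} {r : ℝ} (hζ : ‖ζ‖ = 1) (hz : ‖z‖ ≤ r) :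
    1 - r ≤ ‖ζ - z‖ := by
  have := norm_sub_norm_le ζ z
  linarith

/-- Used twice: varying ζ controls the effect of moving mass along the circle, varying z the effect
of the dilation z ↦ ρz. -/
theorem norm_herglotz_sub_le {ζ ζ' z z' : ℂ} {r : ℝ} (hr : r < 1) (hζ : ‖ζ‖ = 1) (hζ' : ‖ζ'‖ = 1)
    (hz : ‖z‖ ≤ r) (hz' : ‖z'‖ ≤ r) :
    ‖(ζ + z) / (ζ - z) - (ζ' + z') / (ζ' - z')‖ ≤ 2 * (‖ζ - ζ'‖ + ‖z - z'‖) / (1 - r) ^ 2 := by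
  have h1 := one_sub_le_norm_sub hζ hz
  have h2 := one_sub_le_norm_sub hζ' hz'
  have hr' : 0 < 1 - r := sub_pos.2 hr
  have h3 : ζ - z ≠ 0 := norm_pos_iff.1 (hr'.trans_le h1)
  have h4 : ζ' - z' ≠ 0 := norm_pos_iff.1 (hr'.trans_le h2)
  have h5 : (ζ + z) / (ζ - z) - (ζ' + z') / (ζ' - z') =
      2 * (ζ * (z - z') - z * (ζ - ζ')) / ((ζ - z) * (ζ' - z')) := by
    field_simp
    ring
  have h6 : ‖ζ * (z - z') - z * (ζ - ζ')‖ ≤ ‖ζ - ζ'‖ + ‖z - z'‖ := by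
    refine (norm_sub_le _ _).trans ?_
    rw [norm_mul, norm_mul, hζ, one_mul, add_comm]
    gcongr
    exact mul_le_of_le_one_left (norm_nonneg _) (hz.trans hr.le)
  rw [h5, norm_div, norm_mul, norm_mul, Complex.norm_ofNat, sq]
  gcongr

theorem re_herglotz_nonneg {ζ z : ℂ} (hζ : ‖ζ‖ = 1) (hz : ‖z‖ < 1) :
    0 ≤ ((ζ + z) / (ζ - z)).re := by
  have h := congrFun (poissonKernel_eq_re_herglotzRieszKernel (c := 0) (w := z)) ζ
  simp only [poissonKernel, herglotzRieszKernel, Function.comp_apply, sub_zero, hζ] at h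
  rw [← h]
  have : ‖z‖ ^ 2 ≤ 1 := pow_le_one₀ (norm_nonneg _) hz.le
  exact div_nonneg (by linarith) (sq_nonneg _)

theorem circle_sub_ne_zero (ζ : Circle) {z : ℂ} (hz : ‖z‖ < 1) : (ζ : ℂ) - z ≠ 0 :=
  norm_pos_iff.1 ((sub_pos.2 hz).trans_le (one_sub_le_norm_sub (Circle.norm_coe ζ) le_rfl))

theorem continuous_circle_coe : Continuous fun ζ : Circle => (ζ : ℂ) := continuous_subtype_val

theorem continuous_herglotz {z : ℂ} (hz : ‖z‖ < 1) :
    Continuous fun ζ : Circle => ((ζ : ℂ) + z) / ((ζ : ℂ) - z) :=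
  (continuous_circle_coe.add continuous_const).div (continuous_circle_coe.sub continuous_const)
    fun ζ => circle_sub_ne_zero ζ hz

theorem integrable_herglotz (ν : Measure Circle) [IsFiniteMeasure ν] {z : ℂ} (hz : ‖z‖ < 1) :
    Integrable (fun ζ : Circle => ((ζ : ℂ) + z) / ((ζ : ℂ) - z)) ν :=
  (continuous_herglotz hz).integrable_of_hasCompactSupport (HasCompactSupport.of_compactSpace _)

/-- The Herglotz integral of a measure on the circle. -/
noncomputable def herglotzIntegral (ν : Measure Circle) (z : ℂ) : ℂ :=
  ∫ ζ : Circle, ((ζ : ℂ) + z) / ((ζ : ℂ) - z) ∂ν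

theorem singularInner_eq_exp (ν : Measure Circle) (z : ℂ) :
    singularInner ν z = Complex.exp (-herglotzIntegral ν z) := rfl

theorem re_herglotzIntegral (ν : Measure Circle) [IsFiniteMeasure ν] {z : ℂ} (hz : ‖z‖ < 1) :
    (herglotzIntegral ν z).re = ∫ ζ : Circle, (((ζ : ℂ) + z) / ((ζ : ℂ) - z)).re ∂ν :=
  (integral_re (integrable_herglotz ν hz)).symm

theorem re_herglotzIntegral_nonneg (ν : Measure Circle) [IsFiniteMeasure ν] {z : ℂ}
    (hz : ‖z‖ < 1) : 0 ≤ (herglotzIntegral ν z).re := by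
  rw [re_herglotzIntegral ν hz]
  exact integral_nonneg fun ζ => re_herglotz_nonneg (Circle.norm_coe ζ) hz

theorem norm_herglotzIntegral_sub_le (ν : Measure Circle) [IsProbabilityMeasure ν] {z z' : ℂ}
    {r : ℝ} (hr : r < 1) (hz : ‖z‖ ≤ r) (hz' : ‖z'‖ ≤ r) :
    ‖herglotzIntegral ν z - herglotzIntegral ν z'‖ ≤ 2 * ‖z - z'‖ / (1 - r) ^ 2 := by
  rw [herglotzIntegral, herglotzIntegral, ← integral_sub (integrable_herglotz ν (hz.trans_lt hr))
    (integrable_herglotz ν (hz'.trans_lt hr))]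
  refine (norm_integral_le_of_norm_le_const (C := 2 * ‖z - z'‖ / (1 - r) ^ 2) ?_).trans (by simp)
  refine ae_of_all _ fun ζ => ?_
  simpa using norm_herglotz_sub_le hr (Circle.norm_coe ζ) (Circle.norm_coe ζ) hz hz'

theorem differentiableAt_herglotzIntegral (ν : Measure Circle) [IsFiniteMeasure ν] {z : ℂ}
    (hz : ‖z‖ < 1) : DifferentiableAt ℂ (herglotzIntegral ν) z := by
  obtain ⟨r, hzr, hr⟩ := exists_between hz
  have hball : ∀ u ∈ Metric.ball (0 : ℂ) r, ‖u‖ < 1 := fun u hu =>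
    (mem_ball_zero_iff.1 hu).trans hr
  have hs : Metric.ball (0 : ℂ) r ∈ 𝓝 z := Metric.isOpen_ball.mem_nhds (mem_ball_zero_iff.2 hzr)
  refine (hasDerivAt_integral_of_dominated_loc_of_deriv_le (μ := ν) (s := Metric.ball 0 r)
    (bound := fun _ => 2 / (1 - r) ^ 2)
    (F := fun u (ζ : Circle) => ((ζ : ℂ) + u) / ((ζ : ℂ) - u))
    (F' := fun u (ζ : Circle) => 2 * (ζ : ℂ) / ((ζ : ℂ) - u) ^ 2) hs ?_
    (integrable_herglotz ν hz) ?_ ?_ (integrable_const _) ?_).2.differentiableAt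
  · filter_upwards [hs] with u hu
    exact (integrable_herglotz ν (hball u hu)).aestronglyMeasurable
  · refine Continuous.aestronglyMeasurable ?_
    exact (continuous_const.mul continuous_circle_coe).div
      ((continuous_circle_coe.sub continuous_const).pow 2)
      fun ζ => pow_ne_zero 2 (circle_sub_ne_zero ζ hz)
  · refine ae_of_all _ fun ζ u hu => ?_
    have h1 := one_sub_le_norm_sub (Circle.norm_coe ζ) (mem_ball_zero_iff.1 hu).le
    have h2 : 0 < 1 - r := sub_pos.2 hr
    rw [norm_div, norm_pow, norm_mul, Circle.norm_coe, Complex.norm_ofNat, mul_one]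
    gcongr
  · refine ae_of_all _ fun ζ u hu => ?_
    have h1 := circle_sub_ne_zero ζ (hball u hu)
    have h2 := ((hasDerivAt_id u).const_add (ζ : ℂ)).div ((hasDerivAt_id u).const_sub (ζ : ℂ)) h1
    convert! h2 using 1
    simp only [id]
    ring

theorem differentiableOn_singularInner (ν : Measure Circle) [IsFiniteMeasure ν] :
    DifferentiableOn ℂ (singularInner ν) (Metric.ball 0 1) := fun _ hz =>
  (differentiableAt_herglotzIntegral ν (mem_ball_zero_iff.1 hz)).neg.cexp.differentiableWithinAt

theorem norm_singularInner_le_one (ν : Measure Circle) [IsFiniteMeasure ν] {z : ℂ}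
    (hz : ‖z‖ < 1) : ‖singularInner ν z‖ ≤ 1 := by
  rw [singularInner_eq_exp, Complex.norm_exp, Real.exp_le_one_iff, Complex.neg_re]
  exact neg_nonpos.2 (re_herglotzIntegral_nonneg ν hz)

/-- This is the Poisson formula for the constant function 1. -/
theorem integral_re_herglotz_Ico {z : ℂ} (hz : ‖z‖ < 1) :
    ∫ x in Ico (0 : ℝ) 1, (((Circle.exp (2 * Real.pi * x) : ℂ) + z) /
      ((Circle.exp (2 * Real.pi * x) : ℂ) - z)).re = 1 := by
  have h := (diffContOnCl_const (c := (1 : ℂ)) (𝕜 := ℂ)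
    (s := Metric.ball (0 : ℂ) 1)).circleAverage_re_herglotzRieszKernel_smul'
    (mem_ball_zero_iff.2 hz)
  rw [integral_Ico_eq_integral_Ioc, ← intervalIntegral.integral_of_le zero_le_one]
  rw [intervalIntegral.integral_comp_mul_left (fun t => (((Circle.exp t : ℂ) + z) /
      ((Circle.exp t : ℂ) - z)).re) Real.two_pi_pos.ne']
  simp only [Real.circleAverage, circleMap, sub_zero, zero_add, Complex.ofReal_one, one_mul,
    Complex.real_smul, mul_one, intervalIntegral.integral_ofReal] at h
  simp only [Circle.coe_exp, mul_zero, mul_one, smul_eq_mul]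
  exact_mod_cast h

/-! ### The singular measure and the growth of its Poisson integral -/

theorem circleLebesgue_preimage_arg_eq_zero {E : Set ℝ} (hE : MeasurableSet E)
    (h0 : volume E = 0) :
    circleLebesgue {ζ : Circle | Complex.arg ζ / (2 * Real.pi) ∈ E} = 0 := by
  have hm : MeasurableSet {ζ : Circle | Complex.arg ζ / (2 * Real.pi) ∈ E} :=
    ((Complex.measurable_arg.comp continuous_circle_coe.measurable).div_const _) hE
  rw [circleLebesgue, Measure.smul_apply, Measure.map_apply Circle.exp.continuous.measurable hm,
    Measure.restrict_apply (Circle.exp.continuous.measurable hm)]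
  have h1 : volume ((fun t => (2 * Real.pi)⁻¹ * t) ⁻¹' E) = 0 := by
    rw [Real.volume_preimage_mul_left (inv_ne_zero Real.two_pi_pos.ne'), h0, mul_zero]
  rw [measure_mono_null ?_ h1, smul_zero]
  rintro t ⟨ht, htI⟩
  have ht' : Complex.arg (Circle.exp t) / (2 * Real.pi) ∈ E := ht
  rw [Circle.arg_exp htI.1 htI.2, div_eq_inv_mul] at ht'
  exact ht'

theorem exists_arg_circle_exp_eq (x : ℝ) :
    ∃ i : ℤ, Complex.arg (Circle.exp (2 * Real.pi * x)) / (2 * Real.pi) = x - i := by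
  obtain ⟨i, hi⟩ := Circle.exp_eq_exp.1 (Circle.exp_arg (Circle.exp (2 * Real.pi * x)))
  refine ⟨-i, ?_⟩
  rw [hi]
  push_cast
  field_simp
  ring

theorem norm_circle_exp_sub_le (s t : ℝ) : ‖(Circle.exp s : ℂ) - Circle.exp t‖ ≤ |s - t| := by
  have h : (Circle.exp s : ℂ) - Circle.exp t =
      Circle.exp t * (Complex.exp (Complex.I * (s - t : ℝ)) - 1) := by
    rw [mul_sub, mul_one, Circle.coe_exp, Circle.coe_exp, ← Complex.exp_add]
    congr 2
    push_cast
    ring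
  rw [h, norm_mul, Circle.norm_coe, one_mul]
  simpa using Real.norm_exp_I_mul_ofReal_sub_one_le (x := s - t)

/-- The law of `exp (2 π i x)`, where `x` is obtained from a uniformly distributed number in
`[0, 1)` by erasing the binary digits with indices in the range of `m`. -/
noncomputable def erasedDigitsMeasure (m : ℕ → ℕ) : Measure Circle :=
  (volume.restrict (Ico (0 : ℝ) 1)).map fun x => Circle.exp (2 * Real.pi * eraseAllDigits m x)

theorem measurable_circle_exp_two_pi_mul : Measurable fun x : ℝ => Circle.exp (2 * Real.pi * x) :=
  (Circle.exp.continuous.comp (continuous_const_mul _)).measurable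

theorem measurable_circle_exp_eraseAllDigits {m : ℕ → ℕ} (hm0 : ∀ n, 0 < m n) :
    Measurable fun x : ℝ => Circle.exp (2 * Real.pi * eraseAllDigits m x) :=
  measurable_circle_exp_two_pi_mul.comp (measurable_eraseAllDigits hm0)

instance isProbabilityMeasure_restrict_Ico :
    IsProbabilityMeasure (volume.restrict (Ico (0 : ℝ) 1)) := ⟨by simp⟩

theorem isProbabilityMeasure_erasedDigitsMeasure {m : ℕ → ℕ} (hm0 : ∀ n, 0 < m n) :
    IsProbabilityMeasure (erasedDigitsMeasure m) :=
  Measure.isProbabilityMeasure_map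
    (measurable_circle_exp_eraseAllDigits hm0).aemeasurable

theorem mutuallySingular_erasedDigitsMeasure {m : ℕ → ℕ} (hm : StrictMono m)
    (hm0 : ∀ n, 0 < m n) : erasedDigitsMeasure m ⟂ₘ circleLebesgue := by
  set E := ⋂ n, digitsVanish m n
  have hEm : MeasurableSet E := MeasurableSet.iInter fun n => measurableSet_digitsVanish m n
  have hS : MeasurableSet {ζ : Circle | Complex.arg ζ / (2 * Real.pi) ∈ E} :=
    ((Complex.measurable_arg.comp continuous_circle_coe.measurable).div_const _) hEm
  refine (Measure.MutuallySingular.mk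
    (circleLebesgue_preimage_arg_eq_zero hEm (volume_iInter_digitsVanish hm hm0))
    (t := {ζ : Circle | Complex.arg ζ / (2 * Real.pi) ∈ E}ᶜ) ?_ (by simp)).symm
  rw [erasedDigitsMeasure, Measure.map_apply
    (measurable_circle_exp_eraseAllDigits hm0) hS.compl]
  convert! measure_empty (μ := volume.restrict (Ico (0 : ℝ) 1))
  refine eq_empty_of_forall_notMem fun x hx => hx ?_
  obtain ⟨i, hi⟩ := exists_arg_circle_exp_eq (eraseAllDigits m x)
  rw [mem_ofPred_eq, hi]
  exact sub_intCast_mem_iInter_digitsVanish hm0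
    (eraseAllDigits_mem_iInter_digitsVanish hm hm0 x) i

/-- The term 2^n comes from the law after n erasures, which is at most 2^n times Lebesgue measure.
The other term is the Lipschitz constant 4π/(1 - r)^2 of the kernel in x times the displacement 2 ·
2^(-m n) of the later erasures. -/
theorem re_herglotzIntegral_erasedDigitsMeasure_le {m : ℕ → ℕ} (hm : StrictMono m)
    (hm0 : ∀ n, 0 < m n) {z : ℂ} {r : ℝ} (hr : r < 1) (hz : ‖z‖ ≤ r) (n : ℕ) :
    (herglotzIntegral (erasedDigitsMeasure m) z).re ≤
      2 ^ n + 8 * Real.pi / (1 - r) ^ 2 * (2 ^ m n)⁻¹ := by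
  have hz1 := hz.trans_lt hr
  have := isProbabilityMeasure_erasedDigitsMeasure hm0
  set P : ℝ → ℝ := fun x => (((Circle.exp (2 * Real.pi * x) : ℂ) + z) /
    ((Circle.exp (2 * Real.pi * x) : ℂ) - z)).re with hP
  have hPc : Continuous P := Complex.continuous_re.comp ((continuous_herglotz hz1).comp
    (Circle.exp.continuous.comp (continuous_const_mul _)))
  have hP0 : ∀ x, 0 ≤ P x := fun x => re_herglotz_nonneg (Circle.norm_coe _) hz1
  have hPlip : ∀ x y, P x ≤ P y + 4 * Real.pi / (1 - r) ^ 2 * |y - x| := fun x y => by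
    have h1 := (Complex.abs_re_le_norm _).trans
      (norm_herglotz_sub_le hr (Circle.norm_coe (Circle.exp (2 * Real.pi * x)))
      (Circle.norm_coe (Circle.exp (2 * Real.pi * y))) hz hz)
    have h2 := norm_circle_exp_sub_le (2 * Real.pi * x) (2 * Real.pi * y)
    rw [← mul_sub, abs_mul, abs_of_pos Real.two_pi_pos] at h2
    rw [Complex.sub_re, sub_self, norm_zero, add_zero] at h1
    have h3 : P x - P y ≤ 2 * (2 * Real.pi * |x - y|) / (1 - r) ^ 2 :=
      (le_abs_self _).trans (h1.trans (by gcongr))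
    have h4 : 2 * (2 * Real.pi * |x - y|) / (1 - r) ^ 2 =
        4 * Real.pi / (1 - r) ^ 2 * |y - x| := by
      rw [abs_sub_comm]; ring
    linarith
  -- By 1-periodicity `P` need only be bounded on [0, 1), at distance at most 1 from 0.
  obtain ⟨C, hC⟩ : ∃ C, ∀ x, ‖P x‖ ≤ C := by
    refine ⟨P 0 + 4 * Real.pi / (1 - r) ^ 2 * 1, fun x => ?_⟩
    have h1 : P (Int.fract x) = P x := by
      have h2 : Circle.exp (2 * Real.pi * Int.fract x) = Circle.exp (2 * Real.pi * x) :=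
        Circle.exp_eq_exp.2 ⟨-⌊x⌋, by rw [Int.fract]; push_cast; ring⟩
      simp only [hP, h2]
    rw [Real.norm_of_nonneg (hP0 x), ← h1]
    refine (hPlip _ 0).trans ?_
    gcongr
    rw [zero_sub, abs_neg, abs_of_nonneg (Int.fract_nonneg x)]
    exact (Int.fract_lt_one x).le
  have hint : ∀ (μ : Measure ℝ) [IsFiniteMeasure μ], Integrable P μ := fun μ _ =>
    Integrable.of_bound hPc.aestronglyMeasurable C (ae_of_all _ hC)
  have hintc : ∀ f : ℝ → ℝ, Measurable f →
      Integrable (fun x => P (f x)) (volume.restrict (Ico (0 : ℝ) 1)) := fun f hf =>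
    Integrable.of_bound (hPc.measurable.comp hf).aestronglyMeasurable C
      (ae_of_all _ fun x => hC _)
  have h1 : (herglotzIntegral (erasedDigitsMeasure m) z).re =
      ∫ x in Ico (0 : ℝ) 1, P (eraseAllDigits m x) := by
    rw [re_herglotzIntegral _ hz1]
    exact integral_map (measurable_circle_exp_eraseAllDigits hm0).aemeasurable
      (Complex.continuous_re.comp (continuous_herglotz hz1)).aestronglyMeasurable
  have h2 : ∫ x in Ico (0 : ℝ) 1, P (eraseDigits m n x) ≤ 2 ^ n := by
    calc _ = ∫ x, P x ∂((volume.restrict (Ico (0 : ℝ) 1)).map (eraseDigits m n)) :=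
          (integral_map (measurable_eraseDigits m n).aemeasurable hPc.aestronglyMeasurable).symm
      _ ≤ ∫ x, P x ∂((2 ^ n : ENNReal) • volume.restrict (Ico (0 : ℝ) 1)) :=
          integral_mono_measure (map_eraseDigits_le hm0 n) (ae_of_all _ hP0)
            ((hint _).smul_measure (by simp))
      _ = 2 ^ n := by
          rw [integral_smul_measure, integral_re_herglotz_Ico hz1]
          simp
  rw [h1]
  calc _ ≤ ∫ x in Ico (0 : ℝ) 1, (P (eraseDigits m n x) +
        4 * Real.pi / (1 - r) ^ 2 * (2 * (2 ^ m n)⁻¹)) := by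
        refine integral_mono (hintc _ (measurable_eraseAllDigits hm0))
          ((hintc _ (measurable_eraseDigits m n)).add (integrable_const _)) fun x => ?_
        refine (hPlip _ (eraseDigits m n x)).trans ?_
        gcongr
        exact abs_eraseDigits_sub_eraseAllDigits_le hm hm0 n x
    _ = (∫ x in Ico (0 : ℝ) 1, P (eraseDigits m n x)) +
        4 * Real.pi / (1 - r) ^ 2 * (2 * (2 ^ m n)⁻¹) := by
        rw [integral_add (hintc _ (measurable_eraseDigits m n)) (integrable_const _)]
        simp
    _ ≤ _ := by
        refine add_le_add h2 (le_of_eq ?_)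
        ring

/-- There are singular measures whose Poisson integrals grow arbitrarily slowly. -/
theorem exists_mutuallySingular_re_herglotzIntegral_le (ρ : ℕ → ℝ) (hρ : ∀ n, ρ n < 1) :
    ∃ ν : Measure Circle, IsProbabilityMeasure ν ∧ ν ⟂ₘ circleLebesgue ∧
      ∀ n z, ‖z‖ ≤ ρ n → (herglotzIntegral ν z).re ≤ 2 ^ n + 1 := by
  have h1 : ∀ n, ∀ᶠ k in atTop,
      0 < k ∧ 8 * Real.pi / (1 - ρ n) ^ 2 * ((2 : ℝ) ^ k)⁻¹ ≤ 1 := fun n => by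
    refine (eventually_gt_atTop 0).and ?_
    have h2 : Tendsto (fun k : ℕ => 8 * Real.pi / (1 - ρ n) ^ 2 * ((2 : ℝ) ^ k)⁻¹) atTop (𝓝 0) := by
      simpa using (tendsto_inv_atTop_zero.comp
        (tendsto_pow_atTop_atTop_of_one_lt (one_lt_two (α := ℝ)))).const_mul
          (8 * Real.pi / (1 - ρ n) ^ 2)
    exact h2.eventually_le_const one_pos
  -- The index `m n` is taken so large, depending on `ρ n`, that the displacement error is at most
  -- 1.
  obtain ⟨m, hm, hmn⟩ := extraction_forall_of_eventually h1
  have hm0 := fun n => (hmn n).1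
  refine ⟨erasedDigitsMeasure m, isProbabilityMeasure_erasedDigitsMeasure hm0,
    mutuallySingular_erasedDigitsMeasure hm hm0, fun n z hz => ?_⟩
  have h2 := re_herglotzIntegral_erasedDigitsMeasure_le hm hm0 (hρ n) hz n
  linarith [(hmn n).2]

/-! ### Polynomial approximation of the reciprocal -/

theorem exists_polynomial_norm_sub_le {f : ℂ → ℂ} {R : ℝ} (hR : 1 < R)
    (hf : DifferentiableOn ℂ f (Metric.ball 0 R)) {ε : ℝ} (hε : 0 < ε) :
    ∃ p : Polynomial ℂ, ∀ z ∈ Metric.ball (0 : ℂ) 1, ‖p.eval z - f z‖ ≤ ε := by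
  obtain ⟨R', hR'1, hR'⟩ := exists_between hR
  lift R' to NNReal using zero_le_one.trans hR'1.le
  have hR'1' : 1 < R' := by exact_mod_cast hR'1
  have h := (hf.mono (Metric.closedBall_subset_ball hR')).hasFPowerSeriesOnBall
    (zero_lt_one.trans hR'1')
  have h2 := h.tendstoUniformlyOn' (r' := 1) (by exact_mod_cast hR'1')
  obtain ⟨n, hn⟩ := (Metric.tendstoUniformlyOn_iff.1 h2 ε hε).exists
  refine ⟨∑ i ∈ Finset.range n,
    Polynomial.C ((cauchyPowerSeries f 0 R').coeff i) * Polynomial.X ^ i, fun z hz => ?_⟩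
  have h3 := (hn z (by simpa using hz)).le
  rw [dist_comm, dist_eq_norm] at h3
  have h4 : (cauchyPowerSeries f 0 R').partialSum n (z - 0) = (∑ i ∈ Finset.range n,
      Polynomial.C ((cauchyPowerSeries f 0 R').coeff i) * Polynomial.X ^ i).eval z := by
    rw [FormalMultilinearSeries.partialSum, Polynomial.eval_finsetSum, sub_zero]
    refine Finset.sum_congr rfl fun i _ => ?_
    rw [FormalMultilinearSeries.apply_eq_pow_smul_coeff, Polynomial.eval_mul, Polynomial.eval_C,
      Polynomial.eval_pow, Polynomial.eval_X, smul_eq_mul, mul_comm]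
  rwa [h4] at h3

/-- The polynomial is within δ/2 of exp(H(ρz)), and |θ| ≤ 1 preserves this error. The global bound
uses Re H ≤ M on |z| ≤ ρ. The last hypothesis is exactly what gives |H(ρz) - H(z)| ≤ δ/4 on |z| ≤ r,
after which |e^u - 1| ≤ 2|u| yields the other δ/2. -/
theorem exists_polynomial_norm_singularInner_mul_sub_one_le (ν : Measure Circle)
    [IsProbabilityMeasure ν] {r ρ M δ : ℝ} (hr : r < 1) (hρ0 : 0 < ρ) (hρ : ρ < 1)
    (hM : ∀ z, ‖z‖ ≤ ρ → (herglotzIntegral ν z).re ≤ M) (hδ0 : 0 < δ) (hδ : δ ≤ 1)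
    (hρδ : 8 * (1 - ρ) ≤ δ * (1 - r) ^ 2) :
    ∃ p : Polynomial ℂ, ∀ z, ‖z‖ < 1 →
      ‖singularInner ν z * p.eval z - 1‖ ≤ Real.exp M + 2 ∧
      (‖z‖ ≤ r → ‖singularInner ν z * p.eval z - 1‖ ≤ δ) := by
  have hd : DifferentiableOn ℂ (fun z => Complex.exp (herglotzIntegral ν (ρ * z)))
      (Metric.ball 0 ρ⁻¹) := fun z hz => by
    have h1 : ‖(ρ : ℂ) * z‖ < 1 := by
      rw [norm_mul, Complex.norm_real, Real.norm_of_nonneg hρ0.le]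
      rw [mem_ball_zero_iff] at hz
      exact (mul_lt_mul_of_pos_left hz hρ0).trans_eq (mul_inv_cancel₀ hρ0.ne')
    exact ((differentiableAt_herglotzIntegral ν h1).comp z
      (differentiableAt_id.const_mul _)).cexp.differentiableWithinAt
  obtain ⟨p, hp⟩ := exists_polynomial_norm_sub_le ((one_lt_inv₀ hρ0).2 hρ) hd (half_pos hδ0)
  refine ⟨p, fun z hz => ?_⟩
  have hρz : ‖(ρ : ℂ) * z‖ = ρ * ‖z‖ := by
    rw [norm_mul, Complex.norm_real, Real.norm_of_nonneg hρ0.le]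
  have h1 := norm_singularInner_le_one ν hz
  have h2 := hp z (mem_ball_zero_iff.2 hz)
  have h3 : singularInner ν z * p.eval z - 1 =
      singularInner ν z * (p.eval z - Complex.exp (herglotzIntegral ν (ρ * z))) +
      (singularInner ν z * Complex.exp (herglotzIntegral ν (ρ * z)) - 1) := by ring
  have h4 : ‖singularInner ν z * (p.eval z - Complex.exp (herglotzIntegral ν (ρ * z)))‖ ≤
      δ / 2 := by
    rw [norm_mul]
    exact (mul_le_of_le_one_left (norm_nonneg _) h1).trans h2
  rw [h3]
  refine ⟨(norm_add_le _ _).trans ?_, fun hzr => (norm_add_le _ _).trans ?_⟩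
  · have h5 : ‖Complex.exp (herglotzIntegral ν (ρ * z))‖ ≤ Real.exp M := by
      rw [Complex.norm_exp, Real.exp_le_exp]
      refine hM _ ?_
      rw [hρz]
      exact mul_le_of_le_one_right hρ0.le hz.le
    have h6 : ‖singularInner ν z * Complex.exp (herglotzIntegral ν (ρ * z)) - 1‖ ≤
        Real.exp M + 1 := by
      refine (norm_sub_le _ _).trans ?_
      rw [norm_one, norm_mul]
      gcongr
      exact (mul_le_of_le_one_left (norm_nonneg _) h1).trans h5
    linarith
  · have h5 : ‖herglotzIntegral ν (ρ * z) - herglotzIntegral ν z‖ ≤ δ / 4 := by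
      refine (norm_herglotzIntegral_sub_le ν hr
        (by rw [hρz]; exact (mul_le_of_le_one_left (norm_nonneg _) hρ.le).trans hzr) hzr).trans ?_
      have h7 : ‖(ρ : ℂ) * z - z‖ ≤ 1 - ρ := by
        have : (ρ : ℂ) * z - z = -((1 - ρ : ℝ) * z) := by push_cast; ring
        rw [this, norm_neg, norm_mul, Complex.norm_real, Real.norm_of_nonneg (by linarith)]
        exact mul_le_of_le_one_right (by linarith) hz.le
      rw [div_le_iff₀ (pow_pos (sub_pos.2 hr) 2)]
      linarith
    have h6 : ‖singularInner ν z * Complex.exp (herglotzIntegral ν (ρ * z)) - 1‖ ≤ δ / 2 := by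
      rw [singularInner_eq_exp, ← Complex.exp_add, neg_add_eq_sub]
      refine (Complex.norm_exp_sub_one_le (by linarith)).trans ?_
      linarith
    linarith

/-! ### Choice of the parameters and conclusion -/

theorem exists_lt_one_forall_mul_le {w : ℝ → ℝ} (hw_lim : Tendsto w (𝓝[<] 1) (𝓝 0)) (C : ℝ)
    {ε : ℝ} (hε : 0 < ε) : ∃ r < 1, ∀ t ∈ Ioo r 1, C * w t ≤ ε := by
  have h1 : Tendsto (fun t => C * w t) (𝓝[<] 1) (𝓝 0) := by
    simpa using hw_lim.const_mul C
  obtain ⟨r, hr, hsub⟩ :=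
    mem_nhdsLT_iff_exists_Ioo_subset.1 (h1.eventually_le_const hε)
  exact ⟨r, hr, fun t ht => hsub ht⟩

theorem exists_singular_polynomial_norm_le {w : ℝ → ℝ}
    (hw_mem : ∀ t ∈ Ico (0 : ℝ) 1, w t ∈ Ioo (0 : ℝ) 1)
    (hw_lim : Tendsto w (𝓝[<] 1) (𝓝 0)) :
    ∃ ν : Measure Circle, IsProbabilityMeasure ν ∧ ν ⟂ₘ circleLebesgue ∧
      ∃ p : ℕ → Polynomial ℂ, ∀ n z, ‖z‖ < 1 →
        ‖singularInner ν z * (p n).eval z - 1‖ * w ‖z‖ ≤ 1 / ((n : ℝ) + 1) := by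
  have hδ0 : ∀ n : ℕ, 0 < 1 / ((n : ℝ) + 1) := fun n => Nat.one_div_pos_of_nat
  have hδ1 : ∀ n : ℕ, 1 / ((n : ℝ) + 1) ≤ 1 := fun n =>
    div_le_one_of_le₀ (by linarith [n.cast_nonneg (α := ℝ)]) (by positivity)
  -- The bound 2^n + 1 on Re H is fixed in advance, so `r`, then `ρ`, then `ν` can be chosen without
  -- circularity.
  choose r hr1 hrw using fun n : ℕ =>
    exists_lt_one_forall_mul_le hw_lim (Real.exp (2 ^ n + 1) + 2) (hδ0 n)
  have hρ : ∀ n : ℕ, ∃ ρ : ℝ, 0 < ρ ∧ ρ < 1 ∧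
      8 * (1 - ρ) ≤ 1 / ((n : ℝ) + 1) * (1 - r n) ^ 2 := fun n => by
    have h1 : 0 < 1 / ((n : ℝ) + 1) * (1 - r n) ^ 2 :=
      mul_pos (hδ0 n) (pow_pos (sub_pos.2 (hr1 n)) 2)
    -- The cap 1/2 keeps ρ positive; the other entry secures the closeness condition.
    refine ⟨1 - min (1 / 2) (1 / ((n : ℝ) + 1) * (1 - r n) ^ 2 / 8), ?_, ?_, ?_⟩
    · linarith [min_le_left (1 / 2) (1 / ((n : ℝ) + 1) * (1 - r n) ^ 2 / 8)]
    · linarith [lt_min (by norm_num : (0 : ℝ) < 1 / 2) (div_pos h1 (by norm_num : (0 : ℝ) < 8))]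
    · linarith [min_le_right (1 / 2) (1 / ((n : ℝ) + 1) * (1 - r n) ^ 2 / 8)]
  choose ρ hρ0 hρ1 hρr using hρ
  obtain ⟨ν, hν, hsing, hM⟩ := exists_mutuallySingular_re_herglotzIntegral_le ρ hρ1
  choose p hp using fun n : ℕ => exists_polynomial_norm_singularInner_mul_sub_one_le ν (hr1 n)
    (hρ0 n) (hρ1 n) (hM n) (hδ0 n) (hδ1 n) (hρr n)
  refine ⟨ν, hν, hsing, p, fun n z hz => ?_⟩
  have hw := hw_mem ‖z‖ ⟨norm_nonneg z, hz⟩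
  obtain ⟨h1, h2⟩ := hp n z hz
  -- On |z| ≤ r the error itself is small and w < 1; beyond r the weight beats the global bound
  -- exp(2^n + 1) + 2.
  rcases le_or_gt ‖z‖ (r n) with h | h
  · exact (mul_le_of_le_one_right (norm_nonneg _) hw.2.le).trans (h2 h)
  · exact (mul_le_mul_of_nonneg_right h1 hw.1.le).trans (hrw n _ ⟨h, hz⟩)

theorem mainTheorem3 (w : ℝ → ℝ)
    (hw_mem : ∀ t ∈ Ico (0 : ℝ) 1, w t ∈ Ioo (0 : ℝ) 1)
    (hw_anti : AntitoneOn w (Ico (0 : ℝ) 1))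
    (hw_lim : Tendsto w (𝓝[<] 1) (𝓝 0)) :
    ∃ ν : Measure Circle, IsSingularMeasure ν ∧
      (∃ p : ℕ → Polynomial ℂ,
        (∀ z ∈ Metric.ball (0 : ℂ) 1,
          Tendsto (fun n => singularInner ν z * (p n).eval z) atTop (𝓝 1)) ∧
        (∀ n, ∀ z ∈ Metric.ball (0 : ℂ) 1,
          ‖singularInner ν z * (p n).eval z‖ * w ‖z‖ ≤ 2)) ∧
      IsCyclicInGrowthClass w (singularInner ν) := by
  obtain ⟨ν, hν, hsing, p, hp⟩ := exists_singular_polynomial_norm_le hw_mem hw_lim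
  have hw : ∀ z ∈ Metric.ball (0 : ℂ) 1, w ‖z‖ ∈ Ioo (0 : ℝ) 1 := fun z hz =>
    hw_mem ‖z‖ ⟨norm_nonneg z, mem_ball_zero_iff.1 hz⟩
  have hlim : Tendsto (fun n : ℕ => 1 / ((n : ℝ) + 1)) atTop (𝓝 0) :=
    tendsto_one_div_add_atTop_nhds_zero_nat
  refine ⟨ν, ⟨inferInstance, IsProbabilityMeasure.ne_zero ν, hsing⟩, ⟨p, fun z hz => ?_,
    fun n z hz => ?_⟩, ⟨(differentiableOn_singularInner ν).analyticOnNhd Metric.isOpen_ball,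
    1, fun z hz => ?_⟩, p, fun ε hε => ?_⟩
  · rw [tendsto_iff_norm_sub_tendsto_zero]
    refine squeeze_zero (fun _ => norm_nonneg _)
      (fun n => (le_div_iff₀ (hw z hz).1).2 (hp n z (mem_ball_zero_iff.1 hz))) ?_
    simpa using hlim.div_const (w ‖z‖)
  -- The constant 2 is 1/(n + 1) ≤ 1 from the weighted error plus w < 1 from the constant function
  -- 1.
  · have h1 : ‖singularInner ν z * (p n).eval z‖ ≤
        ‖singularInner ν z * (p n).eval z - 1‖ + 1 := by
      simpa using norm_le_norm_sub_add (singularInner ν z * (p n).eval z) 1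
    have h2 : 1 / ((n : ℝ) + 1) ≤ 1 :=
      div_le_one_of_le₀ (by linarith [n.cast_nonneg (α := ℝ)]) (by positivity)
    calc _ ≤ (‖singularInner ν z * (p n).eval z - 1‖ + 1) * w ‖z‖ :=
          mul_le_mul_of_nonneg_right h1 (hw z hz).1.le
      _ ≤ 2 := by linarith [hp n z (mem_ball_zero_iff.1 hz), (hw z hz).2]
  · exact mul_le_one₀ (norm_singularInner_le_one ν (mem_ball_zero_iff.1 hz)) (hw z hz).1.le
      (hw z hz).2.le
  · filter_upwards [hlim.eventually_le_const hε] with n hn z hz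
    exact (hp n z (mem_ball_zero_iff.1 hz)).trans hn
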